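/- Let $E$ be a finite non-empty set and $X=E^{\mathbb Z}$ with its product $\sigma$-algebra. An interaction $\Phi=\{\Phi_V\}$ is a family of functions $\Phi_V:X\to\mathbb R$, indexed by the finite sets $V\Subset\mathbb Z$, such that $\Phi_V(\sigma)$ depends only on $\sigma_V$. It is uniformly absolutely convergent (UAC) if $\sup_{i}\sum_{V\ni i}\|\Phi_V\|_\infty<\infty$. Put $H^\Phi_\Lambda=\sum_{V\cap\Lambda\ne\emptyset}\Phi_V$ and $$\gamma^\Phi_\Lambda(\omega_\Lambda|\eta_{\Lambda^c})=\frac{e^{-H^\Phi_\Lambda(\omega_\Lambda\eta_{\Lambda^c})}}{\sum_{\xi_\Lambda\in E^\Lambda}e^{-H^\Phi_\Lambda(\xi_\Lambda\eta_{\Lambda^c})}},\qquad (\gamma^\Phi_\Lambda f)(\sigma)=\sum_{\xi_\Lambda\in E^\Lambda}\gamma^\Phi_\Lambda(\xi_\Lambda|\sigma_{\Lambda^c})f(\xi_\Lambda\sigma_{\Lambda^c}).$$ The set $\mathscr G(\Phi)$ of Gibbs measures consists of the probability measures $\mu$ on $X$ with $\int\gamma^\Phi_\Lambda f\,d\mu=\int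 f\,d\mu$ for all $\Lambda\Subset\mathbb Z$ and all $f\in L^1(\mu)$. The Dobrushin uniqueness criterion is $$\bar c(\Phi):=\tfrac12\sup_{i}\sum_{V\ni i}(|V|-1)\,\delta(\Phi_V)<1,\qquad \delta(f)=\sup_{\xi,\eta}|f(\xi)-f(\eta)|.$$ **Theorem.** Let $\Phi$ be a UAC interaction with $\bar c(\Phi)<1$. Let $\Lambda_1,\Lambda_2,\dots$ be any enumeration without repetition of the finite sets $V\Subset\mathbb Z$ with $\min V<0\le\max V$, and for $k\ge0$ let $\Psi^{(k)}$ be the interaction with $\Psi^{(k)}_V=0$ if $V=\Lambda_i$ for some $i\ge k+1$, and $\Psi^{(k)}_V=\Phi_V$ otherwise. Then for every $k\ge 0$, $\bar c(\Psi^{(k)})<1$, there is exactly one Gibbs measure $\nu^{(k)}$ for $\Psi^{(k)}$, the measures $\nu^{(k)}$ and $\nu^{(0)}$ are mutually absolutely continuous, and $$\frac{d\nu^{(k)}}{d\nu^{(0)}}=\frac{e^{-\sum_{i=1}^k\Phi_{\Lambda_i}}}{\int_X e^{-\sum_{i=1}^k\Phi_{\Lambda_i}}\,d\nu^{(0)}},\qquad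 \frac{d\nu^{(0)}}{d\nu^{(k)}}=\frac{e^{\sum_{i=1}^k\Phi_{\Lambda_i}}}{\int_X e^{\sum_{i=1}^k\Phi_{\Lambda_i}}\,d\nu^{(k)}}.$$ **Lemma.** Let $\Psi$ be a UAC interaction with exactly one Gibbs measure $\nu$. Let $A\Subset\mathbb Z$ and let $\mathfrak P$ be an interaction supported on $A$, that is, $\mathfrak P_V=0$ unless $V\subset A$. If $\bar\nu\in\mathscr G(\Psi+\mathfrak P)$, then $\bar\nu\ll\nu$ and $$\frac{d\bar\nu}{d\nu}=\frac{e^{-H^{\mathfrak P}_A}}{\int_X e^{-H^{\mathfrak P}_A}\,d\nu}.$$ -/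

import Mathlib

open MeasureTheory
open scoped ENNReal

noncomputable section

/-- An interaction on `E ^ L`: a family of functions indexed by the finite subsets `V` of the
lattice `L`, the function `Φ V` depending only on the spins in `V`. -/
structure LatticeInteraction (L E : Type*) where
  toFun : Finset L → (L → E) → ℝ
  dependsOn_toFun : ∀ V : Finset L, DependsOn (toFun V) (V : Set L)

namespace LatticeInteraction

variable {L E : Type*}

instance : CoeFun (LatticeInteraction L E) (fun _ => Finset L → (L → E) → ℝ) := ⟨toFun⟩

instance : Add (LatticeInteraction L E) where
  add Φ Ψ :=
    { toFun := fun V ω => Φ V ω + Ψ V ω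
      dependsOn_toFun := fun V _ _ h => by
        simp only [Φ.dependsOn_toFun V h, Ψ.dependsOn_toFun V h] }

/-- The supremum norm of a function, as an extended nonnegative real. -/
def supNorm (f : (L → E) → ℝ) : ℝ≥0∞ := ⨆ ω, ‖f ω‖ₑ

/-- The variation `δ(f) = sup {|f ξ - f η|}` of a function, as an extended nonnegative real. -/
def variation (f : (L → E) → ℝ) : ℝ≥0∞ := ⨆ (ξ) (η), ‖f ξ - f η‖ₑ

/-- Uniform absolute convergence: `sup_i ∑_{V ∋ i} ‖Φ_V‖_∞ < ∞`. -/
def IsUAC (Φ : LatticeInteraction L E) : Prop :=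
  (⨆ i : L, ∑' V : {V : Finset L // i ∈ V}, supNorm (Φ V)) < ∞

/-- The number `c̄(Φ) = (1/2) sup_i ∑_{V ∋ i} (|V| - 1) δ(Φ_V)`. -/
def dobrushinConst (Φ : LatticeInteraction L E) : ℝ≥0∞ :=
  (1 / 2) * ⨆ i : L, ∑' V : {V : Finset L // i ∈ V},
    (((V : Finset L).card : ℝ≥0∞) - 1) * variation (Φ V)

/-- Dobrushin's uniqueness criterion for interactions, `c̄(Φ) < 1`. -/
def DobrushinCriterion (Φ : LatticeInteraction L E) : Prop :=
  Φ.dobrushinConst < 1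

/-- The Hamiltonian in the volume `Λ`: `H_Λ(ω) = ∑_{V ∩ Λ ≠ ∅} Φ_V(ω)`. -/
def hamiltonian (Φ : LatticeInteraction L E) (Λ : Finset L) (ω : L → E) : ℝ :=
  ∑' V : {V : Finset L // ∃ i ∈ V, i ∈ Λ}, Φ V ω

variable [DecidableEq L] [Fintype E]

/-- The partition function `Z_Λ(η)`. Here `Function.updateFinset η Λ ξ` is the configuration
equal to `ξ` on `Λ` and to `η` off `Λ`. -/
def partitionFunction (Φ : LatticeInteraction L E) (Λ : Finset L) (η : L → E) : ℝ :=
  ∑ ξ : Λ → E, Real.exp (-Φ.hamiltonian Λ (Function.updateFinset η Λ ξ))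

/-- The specification density `γ_Λ(ξ | η)`, with `ξ` a configuration in `Λ` and `η` the
boundary condition. -/
def specDensity (Φ : LatticeInteraction L E) (Λ : Finset L) (ξ : Λ → E) (η : L → E) : ℝ :=
  Real.exp (-Φ.hamiltonian Λ (Function.updateFinset η Λ ξ)) / Φ.partitionFunction Λ η

/-- The action of the specification on functions,
`(γ_Λ f)(σ) = ∑_ξ γ_Λ(ξ | σ) f(ξ σ)`. -/
def specAverage (Φ : LatticeInteraction L E) (Λ : Finset L) (f : (L → E) → ℝ) (σ : L → E) : ℝ :=
  ∑ ξ : Λ → E, Φ.specDensity Λ ξ σ * f (Function.updateFinset σ Λ ξ)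

/-- The set of Gibbs measures of `Φ`: the probability measures on `E ^ L` satisfying the DLR
equations `∫ γ_Λ f dμ = ∫ f dμ` for every finite `Λ` and every `μ`-integrable `f`. -/
def gibbsMeasures [MeasurableSpace E] (Φ : LatticeInteraction L E) : Set (Measure (L → E)) :=
  {μ | IsProbabilityMeasure μ ∧ ∀ (Λ : Finset L) (f : (L → E) → ℝ), Integrable f μ →
    Integrable (Φ.specAverage Λ f) μ ∧ ∫ σ, Φ.specAverage Λ f σ ∂μ = ∫ σ, f σ ∂μ}

end LatticeInteraction

/-- The finite subsets of `ℤ` meeting both the negative and the nonnegative half-line, that is,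
with `min V < 0` and `max V ≥ 0`. -/
def crossOriginBonds : Set (Finset ℤ) :=
  {V | (∃ i ∈ V, i < 0) ∧ ∃ j ∈ V, 0 ≤ j}

open Classical in
/-- The intermediate interaction `Ψ^(k)`: the bonds `Λ_i` with `i ≥ k + 1` are removed from `Φ`. -/
def intermediateInteraction {E : Type*} (Φ : LatticeInteraction ℤ E) (Λ : ℕ → Finset ℤ) (k : ℕ) :
    LatticeInteraction ℤ E where
  toFun V ω := if ∃ i, k + 1 ≤ i ∧ Λ i = V then 0 else Φ V ω
  dependsOn_toFun V ξ η h := by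
    simp only [Φ.dependsOn_toFun V h]

end

/-! The density formula rests on one algebraic fact: the energy difference `H_Δ - H_Λ` of one
interaction does not depend on the spins in `Λ`, provided every nonzero bond meeting `Λ` also meets
`Δ`. So if `μ` is Gibbs for `Ψ + P`, with `P` supported on `A`, then weighting `μ` by `exp (H^P_A)`
cancels `P` from all conditional laws, and the normalized result is Gibbs for `Ψ`
(`tilted_hamiltonian_mem_gibbsMeasures`). When `Ψ` has a single Gibbs measure `ν`, this result is
`ν`, and undoing the tilt gives the lemma.

For the theorem, removing bonds cannot increase the Dobrushin constant, so each `Ψ^(k)` has exactly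
one Gibbs measure. Since `Ψ^(0)` and `Ψ^(k)` differ by the `k` bonds `Λ_1, …, Λ_k`, the lemma
applied in both directions gives both densities.

Existence comes from compactness and consistency of the specification. Uniqueness is Dobrushin's
argument: replacing `f` by its single-site average at `i` leaves both integrals unchanged, removes
the oscillation at `i` and spreads it over the other sites with total factor at most `c̄ < 1`.
Iteration makes the difference of integrals vanish (`IsUAC.isComparisonWeight_update`,
`IsUAC.isComparisonWeight_mul`). -/

noncomputable section

open Filter Topology

set_option linter.unusedSectionVars false

namespace LatticeInteraction

/-! ### Summability of the energy. -/

section Summability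

variable {L E : Type*}

theorem abs_le_toReal_supNorm {f : (L → E) → ℝ} (hf : supNorm f ≠ ⊤) (ω : L → E) :
    |f ω| ≤ (supNorm f).toReal := by
  have h : ‖f ω‖ₑ ≤ supNorm f := le_iSup (fun ω => ‖f ω‖ₑ) ω
  have := ENNReal.toReal_mono hf h
  simpa using this

theorem supNorm_ne_top_of_abs_le {f : (L → E) → ℝ} {C : ℝ} (h : ∀ ω, |f ω| ≤ C) :
    supNorm f ≠ ⊤ := by
  refine ne_top_of_le_ne_top (ENNReal.ofReal_ne_top (r := C)) (iSup_le fun ω => ?_)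
  rw [Real.enorm_eq_ofReal_abs]
  exact ENNReal.ofReal_le_ofReal (h ω)

theorem abs_sub_le_toReal_variation {f : (L → E) → ℝ} (hf : variation f ≠ ⊤) (ξ η : L → E) :
    |f ξ - f η| ≤ (variation f).toReal := by
  have h : ‖f ξ - f η‖ₑ ≤ variation f := le_iSup₂ (f := fun ξ η => ‖f ξ - f η‖ₑ) ξ η
  have := ENNReal.toReal_mono hf h
  simpa using this

theorem variation_le_two_mul_supNorm (f : (L → E) → ℝ) : variation f ≤ 2 * supNorm f := by
  refine iSup₂_le fun ξ η => ?_
  calc ‖f ξ - f η‖ₑ ≤ ‖f ξ‖ₑ + ‖f η‖ₑ := enorm_sub_le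
    _ ≤ supNorm f + supNorm f :=
      add_le_add (le_iSup (fun ω => ‖f ω‖ₑ) ξ) (le_iSup (fun ω => ‖f ω‖ₑ) η)
    _ = 2 * supNorm f := (two_mul _).symm

variable {Φ : LatticeInteraction L E}

theorem IsUAC.tsum_mem_ne_top (h : Φ.IsUAC) (i : L) :
    ∑' V : {V : Finset L // i ∈ V}, supNorm (Φ V) ≠ ⊤ :=
  ((le_iSup (fun i : L => ∑' V : {V : Finset L // i ∈ V}, supNorm (Φ V)) i).trans_lt h).ne

theorem IsUAC.tsum_ne_top (h : Φ.IsUAC) (Λ : Finset L) :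
    ∑' V : {V : Finset L // ∃ i ∈ V, i ∈ Λ}, supNorm (Φ V) ≠ ⊤ := by
  have key := ENNReal.tsum_biUnion_le (fun V : Finset L => supNorm (Φ V)) Λ
    (fun i => {V : Finset L | i ∈ V})
  have hs : (⋃ i ∈ Λ, {V : Finset L | i ∈ V}) = {V : Finset L | ∃ i ∈ V, i ∈ Λ} := by
    ext V; simp [and_comm]
  rw [hs] at key
  refine ne_top_of_le_ne_top ?_ key
  exact (ENNReal.sum_lt_top.2 fun i _ => (h.tsum_mem_ne_top i).lt_top).ne

/-- The site `i` is needed: the empty bond occurs in none of the sums that UAC controls. -/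
theorem IsUAC.supNorm_ne_top (h : Φ.IsUAC) {V : Finset L} {i : L} (hi : i ∈ V) :
    supNorm (Φ V) ≠ ⊤ :=
  ENNReal.ne_top_of_tsum_ne_top (h.tsum_mem_ne_top i) ⟨V, hi⟩

theorem IsUAC.summable_supNorm (h : Φ.IsUAC) (Λ : Finset L) :
    Summable fun V : {V : Finset L // ∃ i ∈ V, i ∈ Λ} => (supNorm (Φ V)).toReal :=
  ENNReal.summable_toReal (h.tsum_ne_top Λ)

theorem IsUAC.abs_apply_le (h : Φ.IsUAC) {Λ : Finset L} (V : {V : Finset L // ∃ i ∈ V, i ∈ Λ})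
    (ω : L → E) : |Φ V ω| ≤ (supNorm (Φ V)).toReal := by
  obtain ⟨i, hi, -⟩ := V.2
  exact abs_le_toReal_supNorm (h.supNorm_ne_top hi) ω

theorem IsUAC.summable (h : Φ.IsUAC) (Λ : Finset L) (ω : L → E) :
    Summable fun V : {V : Finset L // ∃ i ∈ V, i ∈ Λ} => Φ V ω :=
  .of_norm_bounded (h.summable_supNorm Λ) fun V => h.abs_apply_le V ω

open Classical in
theorem IsUAC.hasSum_ite (h : Φ.IsUAC) (Λ : Finset L) (ω : L → E) :
    HasSum (fun V : Finset L => if ∃ i ∈ V, i ∈ Λ then Φ V ω else 0) (Φ.hamiltonian Λ ω) := by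
  have := (h.summable Λ ω).hasSum
  have h2 := (hasSum_subtype_iff_indicator (f := fun V : Finset L => Φ V ω)
    (s := {V : Finset L | ∃ i ∈ V, i ∈ Λ})).1 this
  convert! h2 using 2 with V
  simp [Set.indicator_apply]

/-- The energy difference of two nested volumes does not depend on the spins in the smaller one. -/
theorem IsUAC.hamiltonian_sub_congr (h : Φ.IsUAC) {Λ Δ : Finset L}
    (hΔ : ∀ V : Finset L, (∃ i ∈ V, i ∈ Λ) → (∀ ω, Φ V ω = 0) ∨ ∃ i ∈ V, i ∈ Δ) {σ τ : L → E}
    (hστ : ∀ i ∉ Λ, σ i = τ i) :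
    Φ.hamiltonian Δ σ - Φ.hamiltonian Λ σ = Φ.hamiltonian Δ τ - Φ.hamiltonian Λ τ := by
  classical
  rw [← ((h.hasSum_ite Δ σ).sub (h.hasSum_ite Λ σ)).tsum_eq,
    ← ((h.hasSum_ite Δ τ).sub (h.hasSum_ite Λ τ)).tsum_eq]
  refine tsum_congr fun V => ?_
  -- Bonds meeting `Λ` vanish or occur in both energies and cancel; the remaining bonds do not see
  -- the spins in `Λ`.
  by_cases hV : ∃ i ∈ V, i ∈ Λ
  · rcases hΔ V hV with h0 | h1
    · simp [h0]
    · simp [hV, h1]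
  · have : Φ V σ = Φ V τ := Φ.dependsOn_toFun V fun i hi => hστ i fun hi' => hV ⟨i, hi, hi'⟩
    rw [this]

theorem IsUAC.hamiltonian_add {Ψ P : LatticeInteraction L E} (hΨ : Ψ.IsUAC) (hP : P.IsUAC)
    (Λ : Finset L) (ω : L → E) :
    (Ψ + P).hamiltonian Λ ω = Ψ.hamiltonian Λ ω + P.hamiltonian Λ ω :=
  (hΨ.summable Λ ω).tsum_add (hP.summable Λ ω)

theorem IsUAC.add {Ψ P : LatticeInteraction L E} (hΨ : Ψ.IsUAC) (hP : P.IsUAC) :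
    (Ψ + P).IsUAC := by
  refine lt_of_le_of_lt (iSup_le fun i => ?_) (ENNReal.add_lt_top.2 ⟨hΨ, hP⟩)
  refine le_trans ?_ (add_le_add
    (le_iSup (fun i : L => ∑' V : {V : Finset L // i ∈ V}, supNorm (Ψ V)) i)
    (le_iSup (fun i : L => ∑' V : {V : Finset L // i ∈ V}, supNorm (P V)) i))
  rw [← ENNReal.tsum_add]
  refine ENNReal.tsum_le_tsum fun V => iSup_le fun ω => ?_
  exact (enorm_add_le (Ψ V ω) (P V ω)).trans
    (add_le_add (le_iSup (fun ω => ‖Ψ V ω‖ₑ) ω) (le_iSup (fun ω => ‖P V ω‖ₑ) ω))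

end Summability

/-! ### Continuity on the compact configuration space. -/

section Continuity

variable {L E : Type*} [TopologicalSpace E] [DiscreteTopology E]

theorem continuous_toFun (Φ : LatticeInteraction L E) [Nonempty E] (V : Finset L) :
    Continuous (Φ V) := by
  obtain ⟨g, hg⟩ := (dependsOn_iff_exists_comp (f := Φ V) (s := (V : Set L))).1 (Φ.dependsOn_toFun V)
  rw [hg]
  exact (continuous_of_discreteTopology (f := g)).comp
    (continuous_pi fun i => continuous_apply (i : L))

theorem IsUAC.continuous_hamiltonian [Nonempty E] {Φ : LatticeInteraction L E} (h : Φ.IsUAC)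
    (Λ : Finset L) : Continuous (Φ.hamiltonian Λ) :=
  continuous_tsum (fun V => Φ.continuous_toFun V) (h.summable_supNorm Λ) fun V ω => h.abs_apply_le V ω

theorem supNorm_ne_top_of_continuous [Finite E] {f : (L → E) → ℝ} (hf : Continuous f) :
    supNorm f ≠ ⊤ := by
  obtain ⟨C, hC⟩ := isCompact_univ.exists_bound_of_continuousOn hf.continuousOn
  exact supNorm_ne_top_of_abs_le fun ω => hC ω (Set.mem_univ ω)

/-- Only the finitely many subsets of `A` contribute, and each term is bounded, being continuous on
a compact space. -/
theorem isUAC_of_support [Finite E] [Nonempty E] {P : LatticeInteraction L E} {A : Finset L}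
    (hP : ∀ V : Finset L, ¬ V ⊆ A → ∀ ω, P V ω = 0) : P.IsUAC := by
  refine lt_of_le_of_lt (iSup_le fun i => ?_)
    (ENNReal.sum_lt_top (s := A.powerset) (f := fun V => supNorm (P V)).2 fun V _ =>
      (supNorm_ne_top_of_continuous (P.continuous_toFun V)).lt_top)
  refine (ENNReal.tsum_comp_le_tsum_of_injective Subtype.val_injective
    (fun V : Finset L => supNorm (P V))).trans ?_
  rw [tsum_eq_sum]
  intro V hV
  have : ∀ ω, P V ω = 0 := hP V (by simpa using hV)
  simp [supNorm, this]

end Continuity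

/-! ### The finite-volume specification and its consistency. -/

section SiteSum

variable {L E : Type*} [DecidableEq L] [Fintype E]

/-- The sum of `F` over all spin configurations in `Λ`, the others being kept. -/
def siteSum (Λ : Finset L) (F : (L → E) → ℝ) (σ : L → E) : ℝ :=
  ∑ ξ : Λ → E, F (Function.updateFinset σ Λ ξ)

theorem updateFinset_apply_of_notMem (σ : L → E) {Λ : Finset L} (ξ : Λ → E) {i : L}
    (hi : i ∉ Λ) : Function.updateFinset σ Λ ξ i = σ i := by
  simp [Function.updateFinset, hi]

theorem siteSum_congr {Λ : Finset L} (F : (L → E) → ℝ) {σ τ : L → E}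
    (h : ∀ i ∉ Λ, σ i = τ i) : siteSum Λ F σ = siteSum Λ F τ := by
  refine Finset.sum_congr rfl fun ξ _ => congrArg F ?_
  ext i
  by_cases hi : i ∈ Λ
  · simp [Function.updateFinset, hi]
  · simp [Function.updateFinset, hi, h i hi]

theorem siteSum_mul_of_invariant {Λ : Finset L} (F G : (L → E) → ℝ) (σ : L → E)
    (hG : ∀ ξ : Λ → E, G (Function.updateFinset σ Λ ξ) = G σ) :
    siteSum Λ (fun ω => F ω * G ω) σ = siteSum Λ F σ * G σ := by
  simp only [siteSum, hG, Finset.sum_mul]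

theorem siteSum_pos [Nonempty E] (Λ : Finset L) {F : (L → E) → ℝ} (hF : ∀ ω, 0 < F ω)
    (σ : L → E) : 0 < siteSum Λ F σ :=
  Finset.sum_pos (fun _ _ => hF _) Finset.univ_nonempty

/-- Exchanging the `Λ`-part of the configuration in `Δ` with the independent configuration in `Λ` is
an involution of the index set. After it the inner configuration is a free variable, whence the
cardinality. -/
theorem siteSum_siteSum {Λ Δ : Finset L} (h : Λ ⊆ Δ) (F : (L → E) → ℝ) (σ : L → E) :
    siteSum Δ (siteSum Λ F) σ = Fintype.card (Λ → E) * siteSum Δ F σ := by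
  let swap : (Δ → E) × (Λ → E) → (Δ → E) × (Λ → E) := fun p =>
    (fun i => if hi : (i : L) ∈ Λ then p.2 ⟨i, hi⟩ else p.1 i, fun i => p.1 ⟨i, h i.2⟩)
  have hswap : Function.Involutive swap := by
    rintro ⟨ζ, ξ⟩
    refine Prod.ext ?_ ?_
    · ext i
      by_cases hi : (i : L) ∈ Λ <;> simp [swap, hi]
    · ext i
      simp [swap]
  have h1 : siteSum Δ (siteSum Λ F) σ
      = ∑ p : (Δ → E) × (Λ → E), F (Function.updateFinset σ Δ (swap p).1) := by
    rw [Fintype.sum_prod_type]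
    refine Finset.sum_congr rfl fun ζ _ => Finset.sum_congr rfl fun ξ _ => congrArg F ?_
    ext i
    by_cases hi : i ∈ Λ
    · simp [Function.updateFinset, swap, hi, h hi]
    · simp [Function.updateFinset, swap, hi]
  have h2 := Equiv.sum_comp hswap.toPerm
    (fun p : (Δ → E) × (Λ → E) => F (Function.updateFinset σ Δ p.1))
  simp only [Function.Involutive.coe_toPerm] at h2
  rw [h1, h2, Fintype.sum_prod_type]
  simp [siteSum, Finset.mul_sum]

theorem continuous_updateFinset [TopologicalSpace E] (Λ : Finset L) (ξ : Λ → E) :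
    Continuous fun σ : L → E => Function.updateFinset σ Λ ξ := by
  refine continuous_pi fun i => ?_
  by_cases hi : i ∈ Λ
  · simp only [Function.updateFinset, hi, dite_true]; exact continuous_const
  · simp only [Function.updateFinset, hi, dite_false]; exact continuous_apply i

theorem continuous_siteSum [TopologicalSpace E] {F : (L → E) → ℝ} (hF : Continuous F)
    (Λ : Finset L) : Continuous (siteSum Λ F) :=
  continuous_finsetSum _ fun ξ _ => hF.comp (continuous_updateFinset Λ ξ)

variable {Φ : LatticeInteraction L E}

/-- The Boltzmann weight `exp (-H_Λ)`. -/
def boltzmann (Φ : LatticeInteraction L E) (Λ : Finset L) (ω : L → E) : ℝ :=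
  Real.exp (-Φ.hamiltonian Λ ω)

theorem boltzmann_pos (Φ : LatticeInteraction L E) (Λ : Finset L) (ω : L → E) :
    0 < Φ.boltzmann Λ ω := Real.exp_pos _

theorem specAverage_eq_div (Φ : LatticeInteraction L E) (Λ : Finset L) (f : (L → E) → ℝ)
    (σ : L → E) : Φ.specAverage Λ f σ
      = siteSum Λ (fun ω => Φ.boltzmann Λ ω * f ω) σ / siteSum Λ (Φ.boltzmann Λ) σ := by
  simp only [specAverage, specDensity, partitionFunction, siteSum, boltzmann, Finset.sum_div]
  exact Finset.sum_congr rfl fun ξ _ => by ring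

theorem siteSum_boltzmann_mul [Nonempty E] (Φ : LatticeInteraction L E) (Λ : Finset L)
    (f : (L → E) → ℝ) (σ : L → E) : siteSum Λ (fun ω => Φ.boltzmann Λ ω * f ω) σ
      = siteSum Λ (Φ.boltzmann Λ) σ * Φ.specAverage Λ f σ := by
  rw [specAverage_eq_div, mul_div_cancel₀ _ (siteSum_pos Λ (Φ.boltzmann_pos Λ) σ).ne']

theorem specAverage_congr (Φ : LatticeInteraction L E) (Λ : Finset L) (f : (L → E) → ℝ)
    {σ τ : L → E} (h : ∀ i ∉ Λ, σ i = τ i) : Φ.specAverage Λ f σ = Φ.specAverage Λ f τ := by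
  rw [specAverage_eq_div, specAverage_eq_div, siteSum_congr _ h, siteSum_congr _ h]

theorem specAverage_updateFinset (Φ : LatticeInteraction L E) (Λ : Finset L) (f : (L → E) → ℝ)
    (σ : L → E) (ξ : Λ → E) :
    Φ.specAverage Λ f (Function.updateFinset σ Λ ξ) = Φ.specAverage Λ f σ :=
  specAverage_congr Φ Λ f fun _ hi => updateFinset_apply_of_notMem σ ξ hi

theorem specDensity_nonneg (Φ : LatticeInteraction L E) (Λ : Finset L) (ξ : Λ → E)
    (σ : L → E) : 0 ≤ Φ.specDensity Λ ξ σ :=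
  div_nonneg (Real.exp_pos _).le (Finset.sum_nonneg fun _ _ => (Real.exp_pos _).le)

theorem sum_specDensity [Nonempty E] (Φ : LatticeInteraction L E) (Λ : Finset L)
    (σ : L → E) : ∑ ξ, Φ.specDensity Λ ξ σ = 1 := by
  simp only [specDensity, ← Finset.sum_div]
  exact div_self (siteSum_pos Λ (Φ.boltzmann_pos Λ) σ).ne'

/-- The Boltzmann weight of `Δ` is that of `Λ` times a factor constant under changes inside `Λ`, so
both conditional laws agree inside `Λ`. -/
theorem IsUAC.specAverage_specAverage [Nonempty E] (h : Φ.IsUAC) {Λ Δ : Finset L} (hΛ : Λ ⊆ Δ)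
    (f : (L → E) → ℝ) (σ : L → E) :
    Φ.specAverage Δ (Φ.specAverage Λ f) σ = Φ.specAverage Δ f σ := by
  rw [specAverage_eq_div, specAverage_eq_div]
  congr 1
  -- A redundant sum over `Λ` is inserted on both sides, at the cost of this cardinality, so that
  -- the inner sums can be compared pointwise.
  have hcard : (Fintype.card (Λ → E) : ℝ) ≠ 0 := Nat.cast_ne_zero.2 Fintype.card_ne_zero
  refine mul_left_cancel₀ hcard ?_
  rw [← siteSum_siteSum hΛ, ← siteSum_siteSum hΛ]
  congr 1
  ext ω
  set G : (L → E) → ℝ := fun ω => Real.exp (-(Φ.hamiltonian Δ ω - Φ.hamiltonian Λ ω)) with hG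
  have hb : ∀ ω, Φ.boltzmann Δ ω = Φ.boltzmann Λ ω * G ω := fun ω => by
    simp only [boltzmann, hG, ← Real.exp_add]; ring_nf
  have hinv : ∀ ξ : Λ → E, G (Function.updateFinset ω Λ ξ) = G ω := fun ξ => by
    simp only [hG]
    rw [h.hamiltonian_sub_congr (fun V ⟨i, hi, hi'⟩ => Or.inr ⟨i, hi, hΛ hi'⟩)
      fun i hi => updateFinset_apply_of_notMem ω ξ hi]
  calc siteSum Λ (fun ω => Φ.boltzmann Δ ω * Φ.specAverage Λ f ω) ω
      = siteSum Λ (fun ω => Φ.boltzmann Λ ω * (G ω * Φ.specAverage Λ f ω)) ω := by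
        simp only [hb, mul_assoc]
    _ = siteSum Λ (Φ.boltzmann Λ) ω * (G ω * Φ.specAverage Λ f ω) :=
        siteSum_mul_of_invariant _ (fun ω => G ω * Φ.specAverage Λ f ω) ω fun ξ => by
          simp only [hinv, specAverage_updateFinset]
    _ = siteSum Λ (fun ω => Φ.boltzmann Λ ω * f ω) ω * G ω := by
        rw [siteSum_boltzmann_mul]; ring
    _ = siteSum Λ (fun ω => (Φ.boltzmann Λ ω * f ω) * G ω) ω :=
        (siteSum_mul_of_invariant _ G ω hinv).symm
    _ = siteSum Λ (fun ω => Φ.boltzmann Δ ω * f ω) ω := by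
        congr 1; ext ω; rw [hb]; ring

variable [TopologicalSpace E] [DiscreteTopology E] [Nonempty E]

theorem IsUAC.continuous_boltzmann (h : Φ.IsUAC) (Λ : Finset L) : Continuous (Φ.boltzmann Λ) :=
  Real.continuous_exp.comp (h.continuous_hamiltonian Λ).neg

theorem IsUAC.continuous_specAverage (h : Φ.IsUAC) (Λ : Finset L) {f : (L → E) → ℝ}
    (hf : Continuous f) : Continuous (Φ.specAverage Λ f) := by
  have : Φ.specAverage Λ f = fun σ =>
      siteSum Λ (fun ω => Φ.boltzmann Λ ω * f ω) σ / siteSum Λ (Φ.boltzmann Λ) σ :=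
    funext (specAverage_eq_div Φ Λ f)
  rw [this]
  exact (continuous_siteSum ((h.continuous_boltzmann Λ).mul hf) Λ).div
    (continuous_siteSum (h.continuous_boltzmann Λ) Λ)
    fun σ => (siteSum_pos Λ (Φ.boltzmann_pos Λ) σ).ne'

theorem IsUAC.continuous_specDensity (h : Φ.IsUAC) (Λ : Finset L) (ξ : Λ → E) :
    Continuous (Φ.specDensity Λ ξ) :=
  ((h.continuous_boltzmann Λ).comp (continuous_updateFinset Λ ξ)).div
    (continuous_siteSum (h.continuous_boltzmann Λ) Λ)
    fun σ => (siteSum_pos Λ (Φ.boltzmann_pos Λ) σ).ne'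

end SiteSum

end LatticeInteraction

namespace LatticeInteraction

theorem borelSpace_of_discrete (E : Type*) [TopologicalSpace E] [DiscreteTopology E]
    [MeasurableSpace E] [DiscreteMeasurableSpace E] : BorelSpace E :=
  ⟨MeasurableSpace.ext fun s =>
    ⟨fun _ => MeasurableSpace.measurableSet_generateFrom (isOpen_discrete s),
      fun _ => MeasurableSet.of_discrete⟩⟩

/-! ### Existence of Gibbs measures and finite perturbations. -/

section Gibbs

variable {L E : Type*} [DecidableEq L] [Countable L] [Fintype E] [Nonempty E]
  [TopologicalSpace E] [DiscreteTopology E] [MeasurableSpace E] [BorelSpace E]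
  {Φ : LatticeInteraction L E}

theorem integrable_of_continuous {f : (L → E) → ℝ} (hf : Continuous f) (μ : Measure (L → E))
    [IsFiniteMeasure μ] : Integrable f μ :=
  (BoundedContinuousFunction.mkOfCompact ⟨f, hf⟩).integrable μ

/-- The measure `μ γ_Λ`. -/
def specMeasure (Φ : LatticeInteraction L E) (Λ : Finset L) (μ : Measure (L → E)) :
    Measure (L → E) :=
  ∑ ξ : Λ → E, (μ.withDensity fun σ => ENNReal.ofReal (Φ.specDensity Λ ξ σ)).map
    fun σ => Function.updateFinset σ Λ ξ

theorem integral_map_specDensity (h : Φ.IsUAC) (Λ : Finset L) (μ : Measure (L → E))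
    [IsFiniteMeasure μ] {f : (L → E) → ℝ} (hf : Integrable f (Φ.specMeasure Λ μ)) (ξ : Λ → E) :
    Integrable (fun σ => Φ.specDensity Λ ξ σ * f (Function.updateFinset σ Λ ξ)) μ ∧
    ∫ σ, f σ ∂((μ.withDensity fun σ => ENNReal.ofReal (Φ.specDensity Λ ξ σ)).map
        fun σ => Function.updateFinset σ Λ ξ)
      = ∫ σ, Φ.specDensity Λ ξ σ * f (Function.updateFinset σ Λ ξ) ∂μ := by
  have hm : Measurable fun σ : L → E => Function.updateFinset σ Λ ξ :=
    (continuous_updateFinset Λ ξ).measurable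
  have hd : Measurable fun σ => ENNReal.ofReal (Φ.specDensity Λ ξ σ) :=
    (h.continuous_specDensity Λ ξ).measurable.ennreal_ofReal
  have hi := (integrable_finsetSum_measure.1 hf) ξ (Finset.mem_univ ξ)
  have hi2 := (integrable_map_measure hi.aestronglyMeasurable hm.aemeasurable).1 hi
  rw [integrable_withDensity_iff_integrable_smul' hd (ae_of_all _ fun _ => ENNReal.ofReal_lt_top)]
    at hi2
  rw [integral_map hm.aemeasurable hi.aestronglyMeasurable,
    integral_withDensity_eq_integral_toReal_smul hd (ae_of_all _ fun _ => ENNReal.ofReal_lt_top)]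
  simpa only [ENNReal.toReal_ofReal (specDensity_nonneg Φ Λ ξ _), smul_eq_mul,
    Function.comp_apply, and_true] using hi2

/-- Duality between the kernel acting on measures and on functions. Once `μ γ_Λ = μ` is known, it
yields both the integrability and the equality in the DLR condition. -/
theorem integral_specMeasure (h : Φ.IsUAC) (Λ : Finset L) (μ : Measure (L → E))
    [IsFiniteMeasure μ] {f : (L → E) → ℝ} (hf : Integrable f (Φ.specMeasure Λ μ)) :
    Integrable (Φ.specAverage Λ f) μ ∧
    ∫ σ, Φ.specAverage Λ f σ ∂μ = ∫ σ, f σ ∂(Φ.specMeasure Λ μ) := by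
  have key := integral_map_specDensity h Λ μ hf
  refine ⟨integrable_finsetSum _ fun ξ _ => (key ξ).1, ?_⟩
  simp only [specAverage]
  rw [integral_finsetSum _ fun ξ _ => (key ξ).1, specMeasure,
    integral_finsetSum_measure fun ξ hξ => (integrable_finsetSum_measure.1 hf) ξ hξ]
  exact Finset.sum_congr rfl fun ξ _ => (key ξ).2.symm

theorem isFiniteMeasure_specMeasure (h : Φ.IsUAC) (Λ : Finset L) (μ : Measure (L → E))
    [IsFiniteMeasure μ] : IsFiniteMeasure (Φ.specMeasure Λ μ) := by
  have (ξ : Λ → E) : IsFiniteMeasure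
      (μ.withDensity fun σ => ENNReal.ofReal (Φ.specDensity Λ ξ σ)) :=
    isFiniteMeasure_withDensity_ofReal
      (integrable_of_continuous (h.continuous_specDensity Λ ξ) μ).2
  unfold specMeasure
  infer_instance

/-- For a UAC interaction, the DLR equations for continuous functions suffice. -/
theorem IsUAC.mem_gibbsMeasures (h : Φ.IsUAC) {μ : Measure (L → E)} [IsProbabilityMeasure μ]
    (hμ : ∀ (Λ : Finset L) (f : (L → E) → ℝ), Continuous f →
      ∫ σ, Φ.specAverage Λ f σ ∂μ = ∫ σ, f σ ∂μ) : μ ∈ Φ.gibbsMeasures := by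
  refine ⟨inferInstance, fun Λ f hf => ?_⟩
  have hfin := isFiniteMeasure_specMeasure h Λ μ
  -- Bounded continuous functions determine a finite Borel measure, which carries the DLR equation
  -- from continuous to integrable functions.
  have heq : Φ.specMeasure Λ μ = μ :=
    ext_of_forall_integral_eq_of_IsFiniteMeasure fun g => by
      rw [← (integral_specMeasure h Λ μ (integrable_of_continuous g.continuous _)).2,
        hμ Λ g g.continuous]
  have := integral_specMeasure h Λ μ (f := f) (by rwa [heq])
  rwa [heq] at this

/-- The finite-volume Gibbs distribution in `Λ` with boundary condition `σ`. -/
def finiteVolume (Φ : LatticeInteraction L E) (Λ : Finset L) (σ : L → E) : Measure (L → E) :=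
  ∑ ξ : Λ → E, ENNReal.ofReal (Φ.specDensity Λ ξ σ) •
    Measure.dirac (Function.updateFinset σ Λ ξ)

instance isProbabilityMeasure_finiteVolume (Λ : Finset L) (σ : L → E) :
    IsProbabilityMeasure (Φ.finiteVolume Λ σ) := by
  constructor
  simp only [finiteVolume, Measure.coe_finsetSum, Finset.sum_apply, Measure.smul_apply,
    measure_univ, smul_eq_mul, mul_one]
  rw [← ENNReal.ofReal_sum_of_nonneg fun ξ _ => specDensity_nonneg Φ Λ ξ σ, sum_specDensity,
    ENNReal.ofReal_one]

theorem integral_finiteVolume (Φ : LatticeInteraction L E) (Λ : Finset L) (σ : L → E)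
    {f : (L → E) → ℝ} (hf : Continuous f) :
    ∫ ω, f ω ∂(Φ.finiteVolume Λ σ) = Φ.specAverage Λ f σ := by
  rw [finiteVolume, integral_finsetSum_measure]
  · refine Finset.sum_congr rfl fun ξ _ => ?_
    rw [integral_smul_measure, integral_dirac, ENNReal.toReal_ofReal (specDensity_nonneg Φ Λ ξ σ),
      smul_eq_mul]
  · intro ξ _
    exact (integrable_of_continuous hf _).smul_measure ENNReal.ofReal_ne_top

/-- A limit point of the finite-volume distributions with fixed boundary condition is Gibbs:
consistency gives the DLR equation for `Λ` as soon as `Δ ⊇ Λ`, and `γ_Λ f` is continuous, so the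
equation passes to the limit. -/
theorem IsUAC.gibbsMeasures_nonempty (h : Φ.IsUAC) : Φ.gibbsMeasures.Nonempty := by
  obtain ⟨σ⟩ : Nonempty (L → E) := inferInstance
  let F : Finset L → ProbabilityMeasure (L → E) := fun Λ => ⟨Φ.finiteVolume Λ σ, inferInstance⟩
  let U : Ultrafilter (Finset L) := Ultrafilter.of atTop
  have hU : (U : Filter (Finset L)) ≤ atTop := Ultrafilter.of_le _
  obtain ⟨μ, -, hμ⟩ := isCompact_univ.ultrafilter_le_nhds (U.map F) (by simp)
  have hμ' : Tendsto F U (𝓝 μ) := hμ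
  have hlim : ∀ f : (L → E) → ℝ, Continuous f →
      Tendsto (fun Δ => Φ.specAverage Δ f σ) U (𝓝 (∫ ω, f ω ∂(μ : Measure (L → E)))) := by
    intro f hf
    have := ProbabilityMeasure.tendsto_iff_forall_integral_tendsto.1 hμ'
      (BoundedContinuousFunction.mkOfCompact ⟨f, hf⟩)
    refine this.congr fun Δ => ?_
    exact integral_finiteVolume Φ Δ σ hf
  refine ⟨μ, h.mem_gibbsMeasures fun Λ f hf => ?_⟩
  refine tendsto_nhds_unique (hlim _ (h.continuous_specAverage Λ hf)) ((hlim f hf).congr' ?_)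
  filter_upwards [hU (mem_atTop Λ)] with Δ hΔ
  exact (h.specAverage_specAverage hΔ f σ).symm

/-- Reweighting a Gibbs measure of `Ψ + P`, with `P` supported on a finite set, gives a Gibbs
measure of `Ψ`. -/
theorem tilted_hamiltonian_mem_gibbsMeasures {Ψ P : LatticeInteraction L E} {A : Finset L}
    (hΨ : Ψ.IsUAC) (hPA : ∀ V : Finset L, ¬ V ⊆ A → ∀ ω, P V ω = 0) {μ : Measure (L → E)}
    (hμ : μ ∈ (Ψ + P).gibbsMeasures) : μ.tilted (P.hamiltonian A) ∈ Ψ.gibbsMeasures := by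
  have hP : P.IsUAC := isUAC_of_support hPA
  have hΨP := hΨ.add hP
  have := hμ.1
  have hg : Continuous fun ω => Real.exp (P.hamiltonian A ω) :=
    Real.continuous_exp.comp (hP.continuous_hamiltonian A)
  have := isProbabilityMeasure_tilted (integrable_of_continuous hg μ)
  refine hΨ.mem_gibbsMeasures fun Λ f hf => ?_
  rw [integral_tilted, integral_tilted]
  simp only [smul_eq_mul, div_mul_eq_mul_div, integral_div]
  congr 1
  have hdlr : ∀ u : (L → E) → ℝ, Continuous u →
      ∫ σ, Real.exp (P.hamiltonian A σ) * u σ ∂μ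
        = ∫ σ, (Ψ + P).specAverage Λ (fun σ => Real.exp (P.hamiltonian A σ) * u σ) σ ∂μ :=
    fun u hu => (hμ.2 Λ _ (integrable_of_continuous (hg.mul hu) μ)).2.symm
  -- The normalizing constants agree. Averaging both integrands over `Λ` with the specification of
  -- `Ψ + P` makes them equal pointwise.
  rw [hdlr _ (hΨ.continuous_specAverage Λ hf), hdlr f hf]
  congr 1
  ext σ
  rw [specAverage_eq_div, specAverage_eq_div]
  congr 1
  -- Tilting turns the weight of `Ψ + P` in `Λ` into that of `Ψ` times `G`, which is constant under
  -- changes inside `Λ`.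
  set G : (L → E) → ℝ := fun ω => Real.exp (P.hamiltonian A ω - P.hamiltonian Λ ω) with hG
  have hb : ∀ ω, (Ψ + P).boltzmann Λ ω * Real.exp (P.hamiltonian A ω)
      = Ψ.boltzmann Λ ω * G ω := fun ω => by
    simp only [boltzmann, hG, ← Real.exp_add, hΨ.hamiltonian_add hP]; ring_nf
  have hinv : ∀ ξ : Λ → E, G (Function.updateFinset σ Λ ξ) = G σ := fun ξ => by
    simp only [hG]
    rw [hP.hamiltonian_sub_congr (fun V ⟨i, hi, hi'⟩ => ?_)
      fun i hi => updateFinset_apply_of_notMem σ ξ hi]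
    by_cases hV : V ⊆ A
    · exact Or.inr ⟨i, hi, hV hi⟩
    · exact Or.inl (hPA V hV)
  calc siteSum Λ (fun ω => (Ψ + P).boltzmann Λ ω *
        (Real.exp (P.hamiltonian A ω) * Ψ.specAverage Λ f ω)) σ
      = siteSum Λ (fun ω => Ψ.boltzmann Λ ω * (G ω * Ψ.specAverage Λ f ω)) σ := by
        simp only [← mul_assoc, hb]
    _ = siteSum Λ (Ψ.boltzmann Λ) σ * (G σ * Ψ.specAverage Λ f σ) :=
        siteSum_mul_of_invariant _ (fun ω => G ω * Ψ.specAverage Λ f ω) σ fun ξ => by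
          simp only [hinv, specAverage_updateFinset]
    _ = siteSum Λ (fun ω => Ψ.boltzmann Λ ω * f ω) σ * G σ := by
        rw [siteSum_boltzmann_mul]; ring
    _ = siteSum Λ (fun ω => (Ψ.boltzmann Λ ω * f ω) * G ω) σ :=
        (siteSum_mul_of_invariant _ G σ hinv).symm
    _ = siteSum Λ (fun ω => (Ψ + P).boltzmann Λ ω * (Real.exp (P.hamiltonian A ω) * f ω)) σ := by
        congr 1; ext ω; rw [← mul_assoc, hb]; ring

theorem eq_tilted_neg_hamiltonian {Ψ P : LatticeInteraction L E} {A : Finset L}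
    (hΨ : Ψ.IsUAC) (hPA : ∀ V : Finset L, ¬ V ⊆ A → ∀ ω, P V ω = 0) {ν ν' : Measure (L → E)}
    (hν : Ψ.gibbsMeasures = {ν}) (hν' : ν' ∈ (Ψ + P).gibbsMeasures) :
    ν' = ν.tilted fun ω => -P.hamiltonian A ω := by
  have h1 : ν'.tilted (P.hamiltonian A) = ν := by
    have := tilted_hamiltonian_mem_gibbsMeasures hΨ hPA hν'
    rwa [hν] at this
  have := hν'.1
  have hg : Continuous fun ω => Real.exp (P.hamiltonian A ω) :=
    Real.continuous_exp.comp ((isUAC_of_support hPA).continuous_hamiltonian A)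
  rw [← h1]
  exact (tilted_neg_same (integrable_of_continuous hg ν')).symm

theorem rnDeriv_of_finite_perturbation {Ψ P : LatticeInteraction L E} {A : Finset L}
    (hΨ : Ψ.IsUAC) (hPA : ∀ V : Finset L, ¬ V ⊆ A → ∀ ω, P V ω = 0) {ν ν' : Measure (L → E)}
    (hν : Ψ.gibbsMeasures = {ν}) (hν' : ν' ∈ (Ψ + P).gibbsMeasures) :
    ν' ≪ ν ∧ ν'.rnDeriv ν =ᵐ[ν] (fun ω => ENNReal.ofReal
        (Real.exp (-P.hamiltonian A ω) / ∫ σ, Real.exp (-P.hamiltonian A σ) ∂ν)) := by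
  have hprob : IsProbabilityMeasure ν := (hν.symm ▸ Set.mem_singleton ν : ν ∈ Ψ.gibbsMeasures).1
  rw [eq_tilted_neg_hamiltonian hΨ hPA hν hν']
  exact ⟨tilted_absolutelyContinuous _ _, rnDeriv_tilted_left_self
    ((isUAC_of_support hPA).continuous_hamiltonian A).neg.measurable.aemeasurable⟩

end Gibbs

end LatticeInteraction

/-! ### Perturbation of finite Gibbs averages. -/

section GibbsAverage

variable {ι : Type*} [Fintype ι]

/-- The variance is at most the second moment about any point; about the midpoint `c` of the range
of `f` all deviations are at most `a / 2`. -/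
theorem sum_mul_sq_sub_mean_le {p f : ι → ℝ} {a : ℝ} (hp : ∀ x, 0 ≤ p x) (hp1 : ∑ x, p x = 1)
    (hf : ∀ x y, |f x - f y| ≤ a) : ∑ x, p x * (f x - ∑ y, p y * f y) ^ 2 ≤ (a / 2) ^ 2 := by
  have hne : Nonempty ι := by
    by_contra h
    rw [not_nonempty_iff] at h
    simp at hp1
  obtain ⟨x₁, h₁⟩ := Finite.exists_max f
  obtain ⟨x₀, h₀⟩ := Finite.exists_min f
  set c := (f x₁ + f x₀) / 2
  set m := ∑ y, p y * f y
  have hc : ∀ x, (f x - c) ^ 2 ≤ (a / 2) ^ 2 := fun x => by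
    have := (abs_le.1 (hf x₁ x₀)).2
    refine sq_le_sq' ?_ ?_ <;> simp only [c] <;> linarith [h₁ x, h₀ x]
  have h1 : ∑ x, p x * (f x - m) ^ 2 = ∑ x, p x * (f x - c) ^ 2 - (m - c) ^ 2 := by
    have e1 : ∀ e : ℝ, ∑ x, p x * (f x - e) ^ 2 = ∑ x, p x * f x ^ 2 - 2 * e * m + e ^ 2 := by
      intro e
      have : ∀ x, p x * (f x - e) ^ 2 = p x * f x ^ 2 - 2 * e * (p x * f x) + p x * e ^ 2 :=
        fun x => by ring
      simp only [this, Finset.sum_add_distrib, Finset.sum_sub_distrib, ← Finset.mul_sum,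
        ← Finset.sum_mul, hp1, one_mul, m]
    rw [e1, e1]; ring
  rw [h1]
  calc _ ≤ ∑ x, p x * (f x - c) ^ 2 := sub_le_self _ (sq_nonneg _)
    _ ≤ ∑ x, p x * (a / 2) ^ 2 :=
      Finset.sum_le_sum fun x _ => mul_le_mul_of_nonneg_left (hc x) (hp x)
    _ = (a / 2) ^ 2 := by rw [← Finset.sum_mul, hp1, one_mul]

theorem abs_covariance_le {p f h : ι → ℝ} {a b : ℝ} (hp : ∀ x, 0 ≤ p x) (hp1 : ∑ x, p x = 1)
    (ha : 0 ≤ a) (hb : 0 ≤ b) (hf : ∀ x y, |f x - f y| ≤ a) (hh : ∀ x y, |h x - h y| ≤ b) :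
    |∑ x, p x * (f x * h x) - (∑ x, p x * f x) * ∑ x, p x * h x| ≤ a * b / 4 := by
  have h1 : ∑ x, p x * (f x * h x) - (∑ x, p x * f x) * ∑ x, p x * h x
      = ∑ x, p x * (f x - ∑ y, p y * f y) * (h x - ∑ y, p y * h y) := by
    set m := ∑ y, p y * f y
    set n := ∑ y, p y * h y
    have : ∀ x, p x * (f x - m) * (h x - n)
        = p x * (f x * h x) - n * (p x * f x) - m * (p x * h x) + p x * (m * n) :=
      fun x => by ring
    simp only [this, Finset.sum_add_distrib, Finset.sum_sub_distrib, ← Finset.mul_sum,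
      ← Finset.sum_mul, hp1, one_mul]
    ring
  rw [h1]
  refine abs_le_of_sq_le_sq ?_ (by positivity)
  calc _ ≤ (∑ x, p x * (f x - ∑ y, p y * f y) ^ 2) * ∑ x, p x * (h x - ∑ y, p y * h y) ^ 2 :=
      Finset.sum_sq_le_sum_mul_sum_of_sq_le_mul _
        (fun x _ => mul_nonneg (hp x) (sq_nonneg _))
        (fun x _ => mul_nonneg (hp x) (sq_nonneg _)) fun x _ => le_of_eq (by ring)
    _ ≤ (a / 2) ^ 2 * (b / 2) ^ 2 :=
      mul_le_mul (sum_mul_sq_sub_mean_le hp hp1 hf) (sum_mul_sq_sub_mean_le hp hp1 hh)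
        (Finset.sum_nonneg fun x _ => mul_nonneg (hp x) (sq_nonneg _)) (sq_nonneg _)
    _ = (a * b / 4) ^ 2 := by ring

/-- The average of `f` under the probability distribution proportional to `exp u`. -/
def gibbsAverage (u f : ι → ℝ) : ℝ :=
  (∑ x, Real.exp (u x) * f x) / ∑ x, Real.exp (u x)

variable [Nonempty ι]

theorem sum_exp_pos (u : ι → ℝ) : 0 < ∑ x, Real.exp (u x) :=
  Finset.sum_pos (fun _ _ => Real.exp_pos _) Finset.univ_nonempty

/-- Interpolate the exponent linearly from `v` to `u`. The derivative of the average is the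
covariance of `f` and `u - v`, bounded by `a * b / 4` through Cauchy–Schwarz; the mean value
inequality concludes. -/
theorem abs_gibbsAverage_sub_le {u v f : ι → ℝ} {a b : ℝ} (hf : ∀ x y, |f x - f y| ≤ a)
    (hh : ∀ x y, |(u x - v x) - (u y - v y)| ≤ b) :
    |gibbsAverage u f - gibbsAverage v f| ≤ a * b / 4 := by
  obtain ⟨x₀⟩ := ‹Nonempty ι›
  have ha : 0 ≤ a := (abs_nonneg _).trans (hf x₀ x₀)
  have hb : 0 ≤ b := (abs_nonneg _).trans (hh x₀ x₀)
  set h : ι → ℝ := fun x => u x - v x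
  set w : ℝ → ι → ℝ := fun t x => Real.exp (v x + t * h x)
  have hw : ∀ t x, HasDerivAt (fun t => w t x) (w t x * h x) t := fun t x => by
    have : HasDerivAt (fun t => v x + t * h x) (h x) t := by
      simpa using ((hasDerivAt_id t).mul_const (h x)).const_add (v x)
    exact this.exp
  have hW : ∀ t, 0 < ∑ x, w t x := fun t => sum_exp_pos _
  set A : ℝ → ℝ := fun t => (∑ x, w t x * f x) / ∑ x, w t x
  have hA : ∀ t, HasDerivAt A (((∑ x, w t x * h x * f x) * (∑ x, w t x)
      - (∑ x, w t x * f x) * ∑ x, w t x * h x) / (∑ x, w t x) ^ 2) t := fun t =>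
    (HasDerivAt.fun_sum fun x _ => (hw t x).mul_const (f x)).div
      (HasDerivAt.fun_sum fun x _ => hw t x) (hW t).ne'
  have hbound : ∀ t, ‖((∑ x, w t x * h x * f x) * (∑ x, w t x)
      - (∑ x, w t x * f x) * ∑ x, w t x * h x) / (∑ x, w t x) ^ 2‖ ≤ a * b / 4 := by
    intro t
    have hcov := abs_covariance_le (p := fun x => w t x / ∑ y, w t y) (f := f) (h := h)
      (fun x => div_nonneg (Real.exp_pos _).le (hW t).le)
      (by rw [← Finset.sum_div, div_self (hW t).ne']) ha hb hf hh
    rw [Real.norm_eq_abs]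
    refine le_of_eq_of_le (congrArg _ ?_) hcov
    simp only [div_mul_eq_mul_div, ← Finset.sum_div]
    have e : ∀ x, w t x * (f x * h x) = w t x * h x * f x := fun x => by ring
    simp only [e]
    have := (hW t).ne'
    field_simp
  have := norm_image_sub_le_of_norm_deriv_le_segment_01' (f := A)
    (fun t _ => (hA t).hasDerivWithinAt) (C := a * b / 4) fun t _ => hbound t
  simpa [A, w, h, gibbsAverage] using this

theorem abs_gibbsAverage_sub_le_of_forall {u f g : ι → ℝ} {a : ℝ} (h : ∀ x, |f x - g x| ≤ a) :
    |gibbsAverage u f - gibbsAverage u g| ≤ a := by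
  rw [gibbsAverage, gibbsAverage, ← sub_div, ← Finset.sum_sub_distrib, abs_div,
    abs_of_pos (sum_exp_pos u), div_le_iff₀ (sum_exp_pos u), Finset.mul_sum]
  refine (Finset.abs_sum_le_sum_abs _ _).trans (Finset.sum_le_sum fun x _ => ?_)
  rw [← mul_sub, abs_mul, abs_of_pos (Real.exp_pos _), mul_comm]
  exact mul_le_mul_of_nonneg_right (h x) (Real.exp_pos _).le

end GibbsAverage

namespace LatticeInteraction

/-! ### Dobrushin's influence coefficients. -/

section Influence

variable {L E : Type*} [DecidableEq L] {Φ : LatticeInteraction L E}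

/-- Dobrushin's bound on the influence of the spin at `j` on the conditional law at `i`. -/
def influence (Φ : LatticeInteraction L E) (i j : L) : ℝ≥0∞ :=
  if j = i then 0 else
    (1 / 2) * ∑' V : {V : Finset L // i ∈ V}, if j ∈ (V : Finset L) then variation (Φ V) else 0

/-- After exchanging the sums, a bond `V ∋ i` is counted once for each site of `V` other than `i`,
hence the factor `|V| - 1`. -/
theorem tsum_influence_le (Φ : LatticeInteraction L E) (i : L) :
    ∑' j, Φ.influence i j ≤ Φ.dobrushinConst := by
  have h1 : ∀ j, Φ.influence i j = (1 / 2) * ∑' V : {V : Finset L // i ∈ V},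
      if j ∈ (V : Finset L).erase i then variation (Φ V) else 0 := by
    intro j
    by_cases hj : j = i <;> simp [influence, hj]
  simp only [h1]
  rw [ENNReal.tsum_mul_left, ENNReal.tsum_comm, dobrushinConst]
  gcongr
  refine le_trans (le_of_eq (tsum_congr fun V => ?_)) (le_iSup (fun i : L =>
    ∑' V : {V : Finset L // i ∈ V}, (((V : Finset L).card : ℝ≥0∞) - 1) * variation (Φ V)) i)
  rw [tsum_eq_sum (s := (V : Finset L).erase i) fun j hj => by simp only [hj, if_false],
    Finset.sum_ite_mem, Finset.inter_self, Finset.sum_const, Finset.card_erase_of_mem V.2,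
    nsmul_eq_mul, ENNReal.natCast_sub, Nat.cast_one]

theorem hamiltonian_singleton (Φ : LatticeInteraction L E) (i : L) (ω : L → E) :
    Φ.hamiltonian {i} ω = ∑' V : {V : Finset L // i ∈ V}, Φ V ω := by
  have e : ∀ V : Finset L, (∃ k ∈ V, k ∈ ({i} : Finset L)) ↔ i ∈ V := fun V => by simp
  exact ((Equiv.subtypeEquivRight e).tsum_eq
    (fun V : {V : Finset L // i ∈ V} => Φ V ω))

theorem IsUAC.abs_hamiltonian_singleton_sub_le (h : Φ.IsUAC) {i j : L} (hij : j ≠ i)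
    {σ τ : L → E} (hστ : ∀ k ≠ j, σ k = τ k) :
    |Φ.hamiltonian {i} σ - Φ.hamiltonian {i} τ| ≤ 2 * (Φ.influence i j).toReal := by
  set T : {V : Finset L // i ∈ V} → ℝ≥0∞ :=
    fun V => if j ∈ (V : Finset L) then variation (Φ V) else 0
  have hT : ∑' V, T V ≠ ⊤ := by
    refine ne_top_of_le_ne_top (ENNReal.mul_ne_top ENNReal.ofNat_ne_top (h.tsum_mem_ne_top i))
      (b := 2 * ∑' V : {V : Finset L // i ∈ V}, supNorm (Φ V)) ?_
    rw [← ENNReal.tsum_mul_left]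
    refine ENNReal.tsum_le_tsum fun V => ?_
    by_cases hj : j ∈ (V : Finset L)
    · simpa [T, hj] using variation_le_two_mul_supNorm (Φ V)
    · simp [T, hj]
  have hval : 2 * (Φ.influence i j).toReal = (∑' V, T V).toReal := by
    simp [influence, hij, T]
  have hsum : ∀ ω, Summable fun V : {V : Finset L // i ∈ V} => Φ V ω := fun ω =>
    .of_norm_bounded (ENNReal.summable_toReal (h.tsum_mem_ne_top i)) fun V =>
      abs_le_toReal_supNorm (h.supNorm_ne_top V.2) ω
  rw [hamiltonian_singleton, hamiltonian_singleton, ← (hsum σ).tsum_sub (hsum τ), hval,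
    ENNReal.tsum_toReal_eq (ENNReal.ne_top_of_tsum_ne_top hT)]
  rw [← Real.norm_eq_abs]
  refine tsum_of_norm_bounded (ENNReal.summable_toReal hT).hasSum fun V => ?_
  rw [Real.norm_eq_abs]
  by_cases hj : j ∈ (V : Finset L)
  · have : variation (Φ V) ≠ ⊤ := ne_top_of_le_ne_top
      (ENNReal.mul_ne_top ENNReal.ofNat_ne_top (h.supNorm_ne_top V.2))
      (variation_le_two_mul_supNorm (Φ V))
    simpa [T, hj] using abs_sub_le_toReal_variation this σ τ
  · have : Φ V σ = Φ V τ :=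
      Φ.dependsOn_toFun V fun k hk => hστ k fun hkj => hj (by simpa [hkj] using hk)
    simp [T, hj, this]

end Influence

/-- `d j` bounds the oscillation of `f` under changes of the spin at `j`. -/
def OscBound {L E : Type*} (f : (L → E) → ℝ) (d : L → ℝ) : Prop :=
  ∀ (j : L) (σ τ : L → E), (∀ k ≠ j, σ k = τ k) → |f σ - f τ| ≤ d j

/-! ### Dobrushin uniqueness. -/

section Uniqueness

variable {L E : Type*} [DecidableEq L] [Fintype E] [Nonempty E] {Φ : LatticeInteraction L E}

theorem specAverage_eq_gibbsAverage (Φ : LatticeInteraction L E) (Λ : Finset L)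
    (f : (L → E) → ℝ) (σ : L → E) : Φ.specAverage Λ f σ
      = gibbsAverage (fun ξ : Λ → E => -Φ.hamiltonian Λ (Function.updateFinset σ Λ ξ))
        fun ξ => f (Function.updateFinset σ Λ ξ) :=
  specAverage_eq_div Φ Λ f σ

theorem IsUAC.oscBound_specAverage (h : Φ.IsUAC) (i : L) {f : (L → E) → ℝ} {d : L → ℝ}
    (hf : OscBound f d) : OscBound (Φ.specAverage {i} f)
      fun j => if j = i then 0 else d j + (Φ.influence i j).toReal * d i := by
  intro j σ τ hστ
  by_cases hj : j = i
  · rw [specAverage_congr Φ {i} f (σ := σ) (τ := τ) fun k hk => hστ k (by simp_all)]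
    simp [hj]
  have hupd : ∀ ξ : ({i} : Finset L) → E, ∀ k ≠ j,
      Function.updateFinset σ {i} ξ k = Function.updateFinset τ {i} ξ k := fun ξ k hk => by
    by_cases hki : k ∈ ({i} : Finset L)
    · simp only [Function.updateFinset, hki, dite_true]
    · simp only [Function.updateFinset, hki, dite_false, hστ k hk]
  beta_reduce
  rw [if_neg hj, specAverage_eq_gibbsAverage, specAverage_eq_gibbsAverage]
  refine (abs_sub_le _ (gibbsAverage
    (fun ξ => -Φ.hamiltonian {i} (Function.updateFinset σ {i} ξ))
    fun ξ => f (Function.updateFinset τ {i} ξ)) _).trans (add_le_add ?_ ?_)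
  · exact abs_gibbsAverage_sub_le_of_forall fun ξ => hf j _ _ (hupd ξ)
  -- A change at `j` shifts the energy by at most twice the influence, so the shifts at `ξ` and `ξ'`
  -- differ by at most four times it; this cancels the `1 / 4`.
  · refine (abs_gibbsAverage_sub_le (a := d i) (b := 4 * (Φ.influence i j).toReal)
      (fun ξ ξ' => hf i _ _ fun k hk => ?_) fun ξ ξ' => ?_).trans (le_of_eq (by ring))
    · simp [Function.updateFinset, hk]
    · have h1 := abs_le.1 (h.abs_hamiltonian_singleton_sub_le hj (hupd ξ))
      have h2 := abs_le.1 (h.abs_hamiltonian_singleton_sub_le hj (hupd ξ'))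
      rw [abs_le]
      constructor <;> linarith [h1.1, h1.2, h2.1, h2.2]

variable [TopologicalSpace E]

/-- Change finitely many spins one at a time, then let the finite set grow, using continuity. -/
theorem OscBound.abs_sub_le_tsum {f : (L → E) → ℝ} {d : L → ℝ} (hf : OscBound f d)
    (hc : Continuous f) (hd0 : ∀ j, 0 ≤ d j) (hd : Summable d) (σ τ : L → E) :
    |f σ - f τ| ≤ ∑' j, d j := by
  have hfin : ∀ s : Finset L, |f (s.piecewise σ τ) - f τ| ≤ ∑ j ∈ s, d j := by
    intro s
    induction s using Finset.induction_on with
    | empty => simp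
    | insert j s hj ih =>
      rw [Finset.sum_insert hj, Finset.piecewise_insert]
      refine (abs_sub_le _ (f (s.piecewise σ τ)) _).trans (add_le_add (hf j _ _ ?_) ih)
      intro k hk
      simp [hk]
  have hlim : Tendsto (fun s : Finset L => s.piecewise σ τ) atTop (𝓝 σ) := by
    refine tendsto_pi_nhds.2 fun k => tendsto_const_nhds.congr' ?_
    filter_upwards [mem_atTop ({k} : Finset L)] with s hs
    exact (Finset.piecewise_eq_of_mem _ _ _ (hs (Finset.mem_singleton_self k))).symm
  refine le_of_tendsto (((hc.tendsto σ).comp hlim).sub_const (f τ)).abs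
    (Eventually.of_forall fun s => ?_)
  exact (hfin s).trans (hd.sum_le_tsum s fun j _ => hd0 j)

variable [MeasurableSpace E]

/-- The weights `w` control the difference of the integrals of `μ` and `ν` through the single-site
oscillations of the integrand. -/
def IsComparisonWeight (μ ν : Measure (L → E)) (w : L → ℝ) : Prop :=
  ∀ (f : (L → E) → ℝ) (d : L → ℝ), Continuous f → OscBound f d → (∀ j, 0 ≤ d j) → Summable d →
    |∫ σ, f σ ∂μ - ∫ σ, f σ ∂ν| ≤ ∑' j, w j * d j

variable [Countable L] [DiscreteTopology E] [BorelSpace E] {μ ν : Measure (L → E)}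

theorem isComparisonWeight_two [IsProbabilityMeasure μ] [IsProbabilityMeasure ν] :
    IsComparisonWeight μ ν fun _ => 2 := by
  intro f d hc hf hd0 hd
  obtain ⟨τ⟩ : Nonempty (L → E) := inferInstance
  have key : ∀ ρ : Measure (L → E), IsProbabilityMeasure ρ →
      |∫ σ, f σ ∂ρ - f τ| ≤ ∑' j, d j := by
    intro ρ _
    have h1 : ∫ σ, f σ ∂ρ - f τ = ∫ σ, (f σ - f τ) ∂ρ := by
      rw [integral_sub (integrable_of_continuous hc ρ) (integrable_const _)]; simp
    rw [h1]
    have := norm_integral_le_of_norm_le_const (μ := ρ)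
      (f := fun σ => f σ - f τ) (ae_of_all _ fun σ => hf.abs_sub_le_tsum hc hd0 hd σ τ)
    simpa using this
  rw [tsum_mul_left, two_mul]
  calc _ ≤ |∫ σ, f σ ∂μ - f τ| + |f τ - ∫ σ, f σ ∂ν| := abs_sub_le _ _ _
    _ ≤ _ := add_le_add (key μ inferInstance) (by rw [abs_sub_comm]; exact key ν inferInstance)

theorem summable_mul_of_bounded {w d : L → ℝ} {a : ℝ} (hw0 : ∀ j, 0 ≤ w j) (hwa : ∀ j, w j ≤ a)
    (hd0 : ∀ j, 0 ≤ d j) (hd : Summable d) : Summable fun j => w j * d j :=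
  .of_nonneg_of_le (fun j => mul_nonneg (hw0 j) (hd0 j))
    (fun j => mul_le_mul_of_nonneg_right (hwa j) (hd0 j)) (hd.mul_left a)

/-- By DLR, `f` may be replaced by its average at `i`. Site `i` then contributes nothing directly,
and the share of `d i` passed to the sites `j ≠ i` is weighted by at most `a` times the total
influence. -/
theorem IsUAC.isComparisonWeight_update (h : Φ.IsUAC) (hΦ : Φ.dobrushinConst ≠ ⊤)
    (hμ : μ ∈ Φ.gibbsMeasures) (hν : ν ∈ Φ.gibbsMeasures) {w : L → ℝ} {a : ℝ}
    (hw : IsComparisonWeight μ ν w) (hw0 : ∀ j, 0 ≤ w j) (hwa : ∀ j, w j ≤ a) (i : L) :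
    IsComparisonWeight μ ν (Function.update w i (a * Φ.dobrushinConst.toReal)) := by
  have := hμ.1
  have := hν.1
  intro f d hc hf hd0 hd
  have hne : ∑' j, Φ.influence i j ≠ ⊤ := ne_top_of_le_ne_top hΦ (tsum_influence_le Φ i)
  set c : L → ℝ := fun j => (Φ.influence i j).toReal
  have hc0 : ∀ j, 0 ≤ c j := fun j => ENNReal.toReal_nonneg
  have hcs : Summable c := ENNReal.summable_toReal hne
  have hct : ∑' j, c j ≤ Φ.dobrushinConst.toReal := by
    rw [← ENNReal.tsum_toReal_eq (ENNReal.ne_top_of_tsum_ne_top hne)]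
    exact ENNReal.toReal_mono hΦ (tsum_influence_le Φ i)
  have hcc : Continuous (Φ.specAverage {i} f) := h.continuous_specAverage {i} hc
  have ha : 0 ≤ a := (hw0 i).trans (hwa i)
  have hd' : Summable fun j => if j = i then 0 else d j + c j * d i :=
    .of_nonneg_of_le (fun j => by
        split_ifs
        · exact le_rfl
        · exact add_nonneg (hd0 j) (mul_nonneg (hc0 j) (hd0 i)))
      (fun j => by
        split_ifs
        · exact add_nonneg (hd0 j) (mul_nonneg (hc0 j) (hd0 i))
        · exact le_rfl) (hd.add (hcs.mul_right (d i)))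
  have h1 := hw _ _ hcc (h.oscBound_specAverage i hf)
    (fun j => by
      split_ifs
      · exact le_rfl
      · exact add_nonneg (hd0 j) (mul_nonneg (hc0 j) (hd0 i))) hd'
  rw [(hμ.2 {i} f (integrable_of_continuous hc μ)).2,
    (hν.2 {i} f (integrable_of_continuous hc ν)).2] at h1
  refine h1.trans ?_
  set w₀ : L → ℝ := Function.update w i 0
  have hw₀0 : ∀ j, 0 ≤ w₀ j := fun j => by
    by_cases hj : j = i <;> simp [w₀, hj, hw0]
  have hw₀a : ∀ j, w₀ j ≤ a := fun j => by
    by_cases hj : j = i <;> simp [w₀, hj, ha, hwa]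
  have hs0 : Summable fun j => w₀ j * d j := summable_mul_of_bounded hw₀0 hw₀a hd0 hd
  have hs1 : Summable fun j => w₀ j * c j := summable_mul_of_bounded hw₀0 hw₀a hc0 hcs
  have e1 : ∀ j, w j * (if j = i then 0 else d j + c j * d i)
      = w₀ j * d j + w₀ j * c j * d i := fun j => by
    by_cases hj : j = i
    · simp [w₀, hj]
    · simp [w₀, hj]; ring
  have e2 : ∀ j, Function.update w i (a * Φ.dobrushinConst.toReal) j * d j
      = w₀ j * d j + if j = i then a * Φ.dobrushinConst.toReal * d i else 0 := fun j => by
    by_cases hj : j = i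
    · subst hj; simp [w₀]
    · simp [w₀, hj]
  have hle : ∑' j, w₀ j * c j ≤ a * Φ.dobrushinConst.toReal := by
    refine (hs1.tsum_le_tsum (fun j => mul_le_mul_of_nonneg_right (hw₀a j) (hc0 j))
      (hcs.mul_left a)).trans ?_
    rw [tsum_mul_left]
    exact mul_le_mul_of_nonneg_left hct ha
  rw [tsum_congr e1, tsum_congr e2, hs0.tsum_add (hs1.mul_right (d i)), tsum_mul_right,
    hs0.tsum_add (hasSum_ite_eq i _).summable, tsum_ite_eq]
  exact add_le_add le_rfl (mul_le_mul_of_nonneg_right hle (hd0 i))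

theorem IsUAC.isComparisonWeight_mul (h : Φ.IsUAC) (hΦ : Φ.DobrushinCriterion)
    (hμ : μ ∈ Φ.gibbsMeasures) (hν : ν ∈ Φ.gibbsMeasures) {a : ℝ} (ha : 0 ≤ a)
    (hw : IsComparisonWeight μ ν fun _ => a) :
    IsComparisonWeight μ ν fun _ => a * Φ.dobrushinConst.toReal := by
  have hΦ' : Φ.dobrushinConst ≠ ⊤ := (hΦ.trans ENNReal.one_lt_top).ne
  set α := Φ.dobrushinConst.toReal with hα
  have hα0 : 0 ≤ α := ENNReal.toReal_nonneg
  have hα1 : α ≤ 1 := by simpa using ENNReal.toReal_mono ENNReal.one_ne_top hΦ.le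
  -- The sites are improved one at a time; since `α ≤ 1`, the bound `a` on all weights survives each
  -- update.
  have hfin : ∀ s : Finset L, IsComparisonWeight μ ν fun j => if j ∈ s then a * α else a := by
    intro s
    induction s using Finset.induction_on with
    | empty => simpa using hw
    | insert i s hi ih =>
      have := h.isComparisonWeight_update hΦ' hμ hν ih (a := a)
        (fun j => by split_ifs <;> positivity)
        (fun j => by split_ifs <;> nlinarith) i
      convert this using 1
      ext j
      by_cases hj : j = i <;> simp [hj, hα]
  intro f d hc hf hd0 hd
  have hval : ∀ s : Finset L, ∑' j, (if j ∈ s then a * α else a) * d j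
      = a * ∑' j, d j - a * (1 - α) * ∑ j ∈ s, d j := by
    intro s
    have e : ∀ j, (if j ∈ s then a * α else a) * d j
        = a * d j - a * (1 - α) * if j ∈ s then d j else 0 := fun j => by
      split_ifs <;> ring
    have hs : HasSum (fun j => if j ∈ s then d j else 0) (∑ j ∈ s, d j) := by
      have := hasSum_sum_of_ne_finset_zero (f := fun j => if j ∈ s then d j else 0) (s := s)
        (L := .unconditional L) fun j hj => if_neg hj
      rwa [Finset.sum_ite_mem, Finset.inter_self] at this
    simp only [e]
    exact ((hd.hasSum.mul_left a).sub (hs.mul_left _)).tsum_eq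
  rw [tsum_mul_left]
  have hlim : Tendsto (fun s : Finset L => a * ∑' j, d j - a * (1 - α) * ∑ j ∈ s, d j) atTop
      (𝓝 (a * ∑' j, d j - a * (1 - α) * ∑' j, d j)) :=
    tendsto_const_nhds.sub (Tendsto.const_mul _ hd.hasSum)
  have := ge_of_tendsto hlim (Eventually.of_forall fun s => (hfin s f d hc hf hd0 hd).trans_eq
    (hval s))
  refine this.trans_eq (by ring)

theorem IsUAC.gibbsMeasures_subsingleton (h : Φ.IsUAC) (hΦ : Φ.DobrushinCriterion)
    (hμ : μ ∈ Φ.gibbsMeasures) (hν : ν ∈ Φ.gibbsMeasures) : μ = ν := by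
  have := hμ.1
  have := hν.1
  set α := Φ.dobrushinConst.toReal with hα
  have hα0 : 0 ≤ α := ENNReal.toReal_nonneg
  have hα1 : α < 1 := by
    simpa using (ENNReal.toReal_lt_toReal (hΦ.trans ENNReal.one_lt_top).ne ENNReal.one_ne_top).2 hΦ
  have hpow : ∀ n : ℕ, IsComparisonWeight μ ν fun _ => 2 * α ^ n := by
    intro n
    induction n with
    | zero => simpa using isComparisonWeight_two
    | succ n ih =>
      have := h.isComparisonWeight_mul hΦ hμ hν (by positivity) ih
      simpa only [pow_succ, ← mul_assoc] using this
  have hint : ∀ (f : (L → E) → ℝ) (d : L → ℝ), Continuous f → OscBound f d → (∀ j, 0 ≤ d j) →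
      Summable d → ∫ σ, f σ ∂μ = ∫ σ, f σ ∂ν := by
    intro f d hc hf hd0 hd
    have hlim : Tendsto (fun n : ℕ => 2 * α ^ n * ∑' j, d j) atTop (𝓝 (2 * 0 * ∑' j, d j)) :=
      ((tendsto_pow_atTop_nhds_zero_of_lt_one hα0 hα1).const_mul 2).mul_const _
    have hle := ge_of_tendsto hlim (Eventually.of_forall fun n =>
      (hpow n f d hc hf hd0 hd).trans_eq tsum_mul_left)
    rw [mul_zero, zero_mul] at hle
    exact sub_eq_zero.1 (abs_eq_zero.1 (le_antisymm hle (abs_nonneg _)))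
  -- Finite-dimensional marginals determine the measure, and the indicator of a cylinder over `s` is
  -- continuous with oscillation at most one on `s` and zero elsewhere.
  refine IsProjectiveLimit.unique (P := fun s : Finset L => ν.map s.restrict) (fun s => ?_)
    fun s => rfl
  have hmeas : Measurable (s.restrict : (L → E) → (s → E)) := Finset.measurable_restrict s
  ext S hS
  rw [Measure.map_apply hmeas hS, Measure.map_apply hmeas hS]
  have hpre := hmeas hS
  have := hint ((s.restrict ⁻¹' S).indicator 1) (fun j => if j ∈ s then 1 else 0) ?_ ?_
    (fun j => by split_ifs <;> norm_num)
    (summable_of_ne_finset_zero (s := s) fun j hj => if_neg hj)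
  · rw [integral_indicator_one hpre, integral_indicator_one hpre] at this
    exact (measureReal_eq_measureReal_iff).1 this
  · have hcont : Continuous (s.restrict : (L → E) → (s → E)) :=
      continuous_pi fun i => continuous_apply (i : L)
    exact (continuous_of_discreteTopology (f := S.indicator (1 : (s → E) → ℝ))).comp hcont
  · intro j σ τ hστ
    have hind : ∀ σ : L → E, (s.restrict ⁻¹' S).indicator (1 : (L → E) → ℝ) σ
        = S.indicator 1 (s.restrict σ) := fun σ => rfl
    rw [hind, hind]
    beta_reduce
    by_cases hj : j ∈ s
    · rw [if_pos hj]
      by_cases h1 : s.restrict σ ∈ S <;> by_cases h2 : s.restrict τ ∈ S <;>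
        simp [h1, h2]
    · have : s.restrict σ = s.restrict τ := by
        ext k
        exact hστ k fun hk => hj (hk ▸ k.2)
      simp [this, hj]

theorem IsUAC.exists_gibbsMeasures_eq_singleton (h : Φ.IsUAC) (hΦ : Φ.DobrushinCriterion) :
    ∃ ν : Measure (L → E), Φ.gibbsMeasures = {ν} := by
  obtain ⟨ν, hν⟩ := h.gibbsMeasures_nonempty
  exact ⟨ν, Set.eq_singleton_iff_unique_mem.2
    ⟨hν, fun μ hμ => h.gibbsMeasures_subsingleton hΦ hμ hν⟩⟩

end Uniqueness

end LatticeInteraction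

/-! ### Adding and removing finitely many bonds. -/

namespace LatticeInteraction

/-- The interaction `s • Φ`, restricted to the bonds in the finite set `S`. -/
def scaledRestriction {L E : Type*} [DecidableEq L] (Φ : LatticeInteraction L E) (s : ℝ)
    (S : Finset (Finset L)) : LatticeInteraction L E where
  toFun V ω := if V ∈ S then s * Φ V ω else 0
  dependsOn_toFun V ξ η h := by
    simp only [Φ.dependsOn_toFun V h]

theorem scaledRestriction_eq_zero {L E : Type*} [DecidableEq L] (Φ : LatticeInteraction L E)
    (s : ℝ) (S : Finset (Finset L)) (V : Finset L) (hV : ¬ V ⊆ S.biUnion id) (ω : L → E) :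
    Φ.scaledRestriction s S V ω = 0 :=
  if_neg fun h => hV (Finset.subset_biUnion_of_mem id h)

/-- Every bond in `S` must be nonempty in order to meet the union of `S` and enter the energy. -/
theorem hamiltonian_scaledRestriction {L E : Type*} [DecidableEq L] [Finite E] [Nonempty E]
    [TopologicalSpace E] [DiscreteTopology E] (Φ : LatticeInteraction L E) (s : ℝ)
    {S : Finset (Finset L)} (hS : ∀ V ∈ S, V.Nonempty) (ω : L → E) :
    (Φ.scaledRestriction s S).hamiltonian (S.biUnion id) ω = s * ∑ V ∈ S, Φ V ω := by
  classical
  have h := (isUAC_of_support (Φ.scaledRestriction_eq_zero s S)).hasSum_ite (S.biUnion id) ω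
  have h' : HasSum (fun V => if V ∈ S then s * Φ V ω else 0)
      ((Φ.scaledRestriction s S).hamiltonian (S.biUnion id) ω) := by
    convert h using 2 with V
    symm
    by_cases hV : V ∈ S
    · obtain ⟨i, hi⟩ := hS V hV
      rw [if_pos ⟨i, hi, Finset.mem_biUnion.2 ⟨V, hV, hi⟩⟩]
      rfl
    · have : Φ.scaledRestriction s S V ω = 0 := if_neg hV
      simp [this, hV]
  rw [h'.unique (hasSum_sum_of_ne_finset_zero (s := S) fun V hV => if_neg hV),
    Finset.sum_ite_mem, Finset.inter_self, Finset.mul_sum]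

end LatticeInteraction

section Intermediate

open LatticeInteraction

variable {E : Type*} {Φ : LatticeInteraction ℤ E}

open Classical in
theorem intermediateInteraction_apply (Φ : LatticeInteraction ℤ E) (Λ : ℕ → Finset ℤ) (k : ℕ)
    (V : Finset ℤ) (ω : ℤ → E) : intermediateInteraction Φ Λ k V ω
      = if ∃ i, k + 1 ≤ i ∧ Λ i = V then 0 else Φ V ω := rfl

theorem supNorm_intermediateInteraction_le (Φ : LatticeInteraction ℤ E) (Λ : ℕ → Finset ℤ)
    (k : ℕ) (V : Finset ℤ) : supNorm (intermediateInteraction Φ Λ k V) ≤ supNorm (Φ V) := by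
  refine iSup_mono fun ω => ?_
  rw [intermediateInteraction_apply]
  split_ifs <;> simp

theorem variation_intermediateInteraction_le (Φ : LatticeInteraction ℤ E) (Λ : ℕ → Finset ℤ)
    (k : ℕ) (V : Finset ℤ) : variation (intermediateInteraction Φ Λ k V) ≤ variation (Φ V) := by
  refine iSup₂_mono fun ξ η => ?_
  rw [intermediateInteraction_apply, intermediateInteraction_apply]
  split_ifs <;> simp

theorem LatticeInteraction.IsUAC.intermediateInteraction (h : Φ.IsUAC) (Λ : ℕ → Finset ℤ)
    (k : ℕ) : (intermediateInteraction Φ Λ k).IsUAC :=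
  lt_of_le_of_lt (iSup_mono fun _ => ENNReal.tsum_le_tsum fun V =>
    supNorm_intermediateInteraction_le Φ Λ k V) h

theorem LatticeInteraction.DobrushinCriterion.intermediateInteraction (h : Φ.DobrushinCriterion)
    (Λ : ℕ → Finset ℤ) (k : ℕ) : (intermediateInteraction Φ Λ k).DobrushinCriterion := by
  refine lt_of_le_of_lt ?_ h
  unfold dobrushinConst
  gcongr with i V
  exact variation_intermediateInteraction_le Φ Λ k V

theorem LatticeInteraction.ext_apply {Φ Ψ : LatticeInteraction ℤ E} (h : ∀ V ω, Φ V ω = Ψ V ω) :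
    Φ = Ψ := by
  cases Φ
  cases Ψ
  congr
  ext V ω
  exact h V ω

theorem intermediateInteraction_zero_add {Λ : ℕ → Finset ℤ} (hΛ : Set.InjOn Λ (Set.Ici 1))
    (Φ : LatticeInteraction ℤ E) (k : ℕ) :
    intermediateInteraction Φ Λ 0 + Φ.scaledRestriction 1 ((Finset.Icc 1 k).image Λ)
      = intermediateInteraction Φ Λ k := by
  refine ext_apply fun V ω => ?_
  change intermediateInteraction Φ Λ 0 V ω
    + (if V ∈ (Finset.Icc 1 k).image Λ then 1 * Φ V ω else 0) = _
  rw [intermediateInteraction_apply, intermediateInteraction_apply, one_mul]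
  by_cases hV : V ∈ (Finset.Icc 1 k).image Λ
  · obtain ⟨i, hi, rfl⟩ := Finset.mem_image.1 hV
    rw [Finset.mem_Icc] at hi
    rw [if_pos ⟨i, by omega, rfl⟩, if_pos hV, if_neg, zero_add]
    rintro ⟨j, hj, hji⟩
    -- By injectivity, a restored bond is not listed again among the removed ones.
    have := hΛ (Set.mem_Ici.2 (by omega : 1 ≤ j)) (Set.mem_Ici.2 hi.1) hji
    omega
  · rw [if_neg hV, add_zero]
    have : (∃ i, 0 + 1 ≤ i ∧ Λ i = V) ↔ ∃ i, k + 1 ≤ i ∧ Λ i = V := by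
      constructor
      · rintro ⟨i, hi, rfl⟩
        refine ⟨i, ?_, rfl⟩
        by_contra hk
        exact hV (Finset.mem_image_of_mem Λ (Finset.mem_Icc.2 ⟨by omega, by omega⟩))
      · rintro ⟨i, hi, rfl⟩
        exact ⟨i, by omega, rfl⟩
    by_cases h : ∃ i, k + 1 ≤ i ∧ Λ i = V
    · rw [if_pos (this.2 h), if_pos h]
    · rw [if_neg (mt this.1 h), if_neg h]

theorem intermediateInteraction_add_neg {Λ : ℕ → Finset ℤ} (hΛ : Set.InjOn Λ (Set.Ici 1))
    (Φ : LatticeInteraction ℤ E) (k : ℕ) :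
    intermediateInteraction Φ Λ k + Φ.scaledRestriction (-1) ((Finset.Icc 1 k).image Λ)
      = intermediateInteraction Φ Λ 0 := by
  rw [← intermediateInteraction_zero_add hΛ Φ k]
  refine ext_apply fun V ω => ?_
  change intermediateInteraction Φ Λ 0 V ω
    + (if V ∈ (Finset.Icc 1 k).image Λ then 1 * Φ V ω else 0)
    + (if V ∈ (Finset.Icc 1 k).image Λ then -1 * Φ V ω else 0) = _
  split_ifs <;> ring

theorem hamiltonian_scaledRestriction_crossOriginBonds [Finite E] [Nonempty E]
    [TopologicalSpace E] [DiscreteTopology E] {Λ : ℕ → Finset ℤ}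
    (hΛ : Set.BijOn Λ (Set.Ici 1) crossOriginBonds) (Φ : LatticeInteraction ℤ E) (s : ℝ) (k : ℕ)
    (ω : ℤ → E) :
    (Φ.scaledRestriction s ((Finset.Icc 1 k).image Λ)).hamiltonian
      (((Finset.Icc 1 k).image Λ).biUnion id) ω = s * ∑ i ∈ Finset.Icc 1 k, Φ (Λ i) ω := by
  rw [hamiltonian_scaledRestriction, Finset.sum_image]
  · exact hΛ.injOn.mono fun i hi => (Finset.mem_Icc.1 hi).1
  · intro V hV
    obtain ⟨i, hi, rfl⟩ := Finset.mem_image.1 hV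
    obtain ⟨⟨j, hj, -⟩, -⟩ := hΛ.mapsTo (Set.mem_Ici.2 (Finset.mem_Icc.1 hi).1)
    exact ⟨j, hj⟩

end Intermediate

end

theorem mainTheorem7 {E : Type*} [Fintype E] [Nonempty E] [MeasurableSpace E]
    [DiscreteMeasurableSpace E] :
    -- the intermediate interactions; `Λ 1, Λ 2, …` is an enumeration of the cross-origin bonds
    (∀ (Φ : LatticeInteraction ℤ E) (Λ : ℕ → Finset ℤ),
      Φ.IsUAC → Φ.DobrushinCriterion → Set.BijOn Λ (Set.Ici 1) crossOriginBonds →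
      (∀ k : ℕ, (intermediateInteraction Φ Λ k).DobrushinCriterion) ∧
      ∃ ν : ℕ → Measure (ℤ → E),
        (∀ k : ℕ, (intermediateInteraction Φ Λ k).gibbsMeasures = {ν k}) ∧
        ∀ k : ℕ, ν k ≪ ν 0 ∧ ν 0 ≪ ν k ∧
          (ν k).rnDeriv (ν 0) =ᵐ[ν 0] (fun ω => ENNReal.ofReal
            (Real.exp (-∑ i ∈ Finset.Icc 1 k, Φ (Λ i) ω) /
              ∫ σ, Real.exp (-∑ i ∈ Finset.Icc 1 k, Φ (Λ i) σ) ∂(ν 0))) ∧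
          (ν 0).rnDeriv (ν k) =ᵐ[ν k] (fun ω => ENNReal.ofReal
            (Real.exp (∑ i ∈ Finset.Icc 1 k, Φ (Λ i) ω) /
              ∫ σ, Real.exp (∑ i ∈ Finset.Icc 1 k, Φ (Λ i) σ) ∂(ν k)))) ∧
    -- the lemma on finite perturbations `P` supported on a finite set `A`
    (∀ (Ψ P : LatticeInteraction ℤ E) (A : Finset ℤ) (ν ν' : Measure (ℤ → E)),
      Ψ.IsUAC → (∀ V : Finset ℤ, ¬ V ⊆ A → ∀ ω, P V ω = 0) →
      Ψ.gibbsMeasures = {ν} → ν' ∈ (Ψ + P).gibbsMeasures →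
      ν' ≪ ν ∧
      ν'.rnDeriv ν =ᵐ[ν] (fun ω => ENNReal.ofReal
        (Real.exp (-P.hamiltonian A ω) / ∫ σ, Real.exp (-P.hamiltonian A σ) ∂ν))) := by
  -- With the discrete topology the configuration space is compact, and the product σ-algebra is its
  -- Borel σ-algebra.
  let : TopologicalSpace E := ⊥
  have : DiscreteTopology E := ⟨rfl⟩
  have : BorelSpace E := LatticeInteraction.borelSpace_of_discrete E
  refine ⟨fun Φ Λ hΦ hD hΛ => ⟨hD.intermediateInteraction Λ, ?_⟩,
    fun Ψ P A ν ν' hΨ hPA hν hν' => LatticeInteraction.rnDeriv_of_finite_perturbation hΨ hPA hν hν'⟩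
  choose ν hν using fun k => (hΦ.intermediateInteraction Λ k).exists_gibbsMeasures_eq_singleton
    (hD.intermediateInteraction Λ k)
  have hmem : ∀ k, ν k ∈ (intermediateInteraction Φ Λ k).gibbsMeasures := fun k => by
    rw [hν k]; exact Set.mem_singleton _
  refine ⟨ν, hν, fun k => ?_⟩
  obtain ⟨hac, hd⟩ := LatticeInteraction.rnDeriv_of_finite_perturbation (ν' := ν k)
    (hΦ.intermediateInteraction Λ 0) (Φ.scaledRestriction_eq_zero 1 _) (hν 0)
    (by rw [intermediateInteraction_zero_add hΛ.injOn Φ k]; exact hmem k)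
  -- The reverse density comes from the perturbation with opposite sign and the uniqueness of `ν k`.
  obtain ⟨hac', hd'⟩ := LatticeInteraction.rnDeriv_of_finite_perturbation (ν' := ν 0)
    (hΦ.intermediateInteraction Λ k) (Φ.scaledRestriction_eq_zero (-1) _) (hν k)
    (by rw [intermediateInteraction_add_neg hΛ.injOn Φ k]; exact hmem 0)
  simp only [hamiltonian_scaledRestriction_crossOriginBonds hΛ, one_mul, neg_mul, neg_neg]
    at hd hd'
  exact ⟨hac, hac', hd, hd'⟩
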